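/- **Setting.** Let $(\Omega,\mathcal F,P)$ be a probability space, $(\mathcal X,\Sigma)$ a standard Borel space, and $X=(X_t)_{t\in\mathbb R}$ a stochastic process with values in $\mathcal X$. A premetric on $\mathbb R$ is a function $d:\mathbb R\times\mathbb R\to[0,1]$ with $d(t,t')=d(t',t)$ and $d(t,t)=0$. The process $X$ is *locally exchangeable* with respect to $d$ if for every finite $T\subset\mathbb R$ and every injection $\pi:T\to\mathbb R$, $$d_{\mathrm{TV}}\big((X_t)_{t\in T},(X_{\pi(t)})_{t\in T}\big)\le\sum_{t\in T}d(t,\pi(t)),$$ where $d_{\mathrm{TV}}(Y,Z)=\sup_A|P(Y\in A)-P(Z\in A)|$ over measurable sets $A$. A *mixing process* of $X$ is a process $G=(G_t)_{t\in\mathbb R}$ of random probability measures on $\mathcal X$, defined on $\Omega$, such that for all finite $T\subset\mathbb R$ and all $t,t'\in\mathbb R$, $$P\big((X_s)_{s\in T}\in\cdot\mid\sigma(G)\big)=\prod_{s\in T}G_s\ \text{ a.s.},\qquad \sup_{A\in\Sigma}E|G_t(A)-G_{t'}(A)|\le d(t,t').$$ A modification of a process $Y$ is a process $Y'$ on the same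 probability space with $P(Y_t=Y'_t)=1$ for every $t$. **Theorem.** Let $X$ be locally exchangeable with respect to a premetric $d$ on $\mathbb R$, let $\gamma\ge0$, and suppose that $d(t,t')=O(|t-t'|^{1+\gamma})$ as $|t-t'|\to0$, that is, there are $C,\delta>0$ with $d(t,t')\le C|t-t'|^{1+\gamma}$ whenever $|t-t'|<\delta$. 1. If $\gamma>1$, then $X$ is exchangeable (its law is invariant under finite permutations of the index set $\mathbb R$), a mixing process $G$ exists, and every mixing process $G$ is constant up to modification: there is a single random probability measure $G_0$ with $P(G_t=G_0)=1$ for every $t$. 2. If $0<\gamma\le1$, then $X$ is stationary, a mixing process exists, and for every mixing process $G$ and every $A\in\Sigma$ the real process $(G_t(A))_{t\in\mathbb R}$ is weak-sense stationary (square integrable, with mean and autocovariance invariant under translation of $t$) and, for every $\alpha\in(0,\gamma)$, has a modification whose paths are all $\alpha$-Hölder continuous on $\mathbb R$, with a constant that may depend on the path. 3. If $\gamma=0$, a mixing process may have no continuous modification. Precisely, there is a probability space with a random variable $U$ uniform on $[0,1]$ such that the process $X_t=\mathbf 1\{t\ge U\}$, with values in $\mathcal X=\mathbb R$, is locally exchangeable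 with respect to the premetric $d(t,t')=\min(|t-t'|,1)$ (so that $d(t,t')=O(|t-t'|)$); the process $G_t=\mathbf 1\{t<U\}\,\delta_0+\mathbf 1\{t\ge U\}\,\delta_1$ is a mixing process of $X$; and for every mixing process $G$ of $X$, neither $G$ (in the topology of weak convergence of probability measures) nor the real process $(G_t(\{1\}))_{t\in\mathbb R}$ has a modification with almost surely continuous paths. -/

import Mathlib

open MeasureTheory ProbabilityTheory Filter Topology
open scoped NNReal

universe u v

namespace LocalExch

/-- A premetric with values in `[0, 1]`: symmetric and zero on the diagonal. -/
structure IsPremetric {𝒯 : Type*} (d : 𝒯 → 𝒯 → ℝ) : Prop where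
  nonneg : ∀ t t', 0 ≤ d t t'
  le_one : ∀ t t', d t t' ≤ 1
  symm : ∀ t t', d t t' = d t' t
  self : ∀ t, d t t = 0

/-- Total variation distance `sup_A |μ(A) - ν(A)|` over the measurable sets `A`; it is used for
probability measures, for which the supremum is that of a bounded nonempty family. -/
noncomputable def tvDist {𝒴 : Type*} [MeasurableSpace 𝒴] (μ ν : Measure 𝒴) : ℝ :=
  ⨆ A : {A : Set 𝒴 // MeasurableSet A}, |μ.real A - ν.real A|

section Definitions

variable {𝒯 Ω 𝒳 : Type*} [MeasurableSpace Ω] [MeasurableSpace 𝒳]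

/-- The process `X_{π,T}`, with index set `T`, given by `(X_{π,T})_t = X_{π(t)}`. -/
def reindex (X : 𝒯 → Ω → 𝒳) (T : Finset 𝒯) (π : T → 𝒯) : Ω → (T → 𝒳) :=
  fun ω t => X (π t) ω

/-- The restriction `X_T` of `X` to the index set `T`. -/
def restrictTo (X : 𝒯 → Ω → 𝒳) (T : Finset 𝒯) : Ω → (T → 𝒳) :=
  fun ω t => X t ω

/-- Local exchangeability with respect to `d`: for every finite `T` and every injection
`π : T → 𝒯`, the laws of `X_T` and `X_{π,T}` are within `∑ t ∈ T, d(t, π(t))` in total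
variation. -/
def IsLocallyExchangeable (P : Measure Ω) (X : 𝒯 → Ω → 𝒳) (d : 𝒯 → 𝒯 → ℝ) : Prop :=
  ∀ (T : Finset 𝒯) (π : T → 𝒯), Function.Injective π →
    tvDist (P.map (restrictTo X T)) (P.map (reindex X T π)) ≤ ∑ t : T, d t (π t)

/-- Exchangeability: the law of the process on `𝒯 → 𝒳` (product σ-algebra) is invariant under
every finite permutation of the index set. -/
def IsExchangeable (P : Measure Ω) (X : 𝒯 → Ω → 𝒳) : Prop :=
  ∀ σ : Equiv.Perm 𝒯, {t | σ t ≠ t}.Finite →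
    IdentDistrib (fun ω t => X t ω) (fun ω t => X (σ t) ω) P P

/-- Two processes on the same index set are modifications of one another. -/
def IsModification {S : Type*} (P : Measure Ω) (Y Y' : 𝒯 → Ω → S) : Prop :=
  ∀ t, ∀ᵐ ω ∂P, Y t ω = Y' t ω

/-- The σ-algebra `σ(G)` generated by a process of random probability measures. -/
@[reducible] def sigmaOf (G : 𝒯 → Ω → ProbabilityMeasure 𝒳) : MeasurableSpace Ω :=
  ⨆ t, MeasurableSpace.comap (G t) inferInstance

/-- `G` is a mixing measure process of `X` (with smoothness given by `d`): a process of random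
probability measures such that, given `σ(G)`, the variables `X_t`, `t ∈ T`, are independent with
laws `G_t`, for every finite `T`, and such that `sup_A E|G_t(A) - G_{t'}(A)| ≤ d(t, t')`. -/
structure IsMixingProcess (P : Measure Ω) (X : 𝒯 → Ω → 𝒳) (d : 𝒯 → 𝒯 → ℝ)
    (G : 𝒯 → Ω → ProbabilityMeasure 𝒳) : Prop where
  measurable : ∀ t, Measurable (G t)
  condLaw : ∀ (T : Finset 𝒯) (B : Set (T → 𝒳)), MeasurableSet B →
    P[(restrictTo X T ⁻¹' B).indicator (fun _ => (1 : ℝ)) | sigmaOf G]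
      =ᵐ[P] fun ω => (Measure.pi fun t : T => (G t ω : Measure 𝒳)).real B
  smooth : ∀ (t t' : 𝒯) (A : Set 𝒳), MeasurableSet A →
    ∫ ω, |(G t ω : Measure 𝒳).real A - (G t' ω : Measure 𝒳).real A| ∂P ≤ d t t'

/-- The real-valued process `(G_t(A))_t`. -/
noncomputable def evalProcess (G : 𝒯 → Ω → ProbabilityMeasure 𝒳) (A : Set 𝒳) : 𝒯 → Ω → ℝ :=
  fun t ω => (G t ω : Measure 𝒳).real A

/-- `G` is a constant process (up to modification). -/
def IsConstantProcess (P : Measure Ω) (G : 𝒯 → Ω → ProbabilityMeasure 𝒳) : Prop :=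
  ∃ G₀ : Ω → ProbabilityMeasure 𝒳, Measurable G₀ ∧
    IsModification P G (fun _ => G₀)

/-- (Strict) stationarity of a process indexed by `ℝ`. -/
def IsStationary (P : Measure Ω) (X : ℝ → Ω → 𝒳) : Prop :=
  ∀ Δ : ℝ, IdentDistrib (fun ω t => X t ω) (fun ω t => X (t + Δ) ω) P P

/-- Weak-sense stationarity of a real process indexed by `ℝ`: square integrable, with mean and
autocovariance invariant under translation. -/
structure IsWeakSenseStationary (P : Measure Ω) (Y : ℝ → Ω → ℝ) : Prop where
  memLp : ∀ t, MemLp (Y t) 2 P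
  mean : ∀ t Δ, P[Y (t + Δ)] = P[Y t]
  autocov : ∀ s t Δ, cov[Y (s + Δ), Y (t + Δ); P] = cov[Y s, Y t; P]

/-- `Y` has a modification all of whose paths are `α`-Hölder continuous on `ℝ` (with a constant
that may depend on the path). -/
def HasHolderModification (P : Measure Ω) (Y : ℝ → Ω → ℝ) (α : ℝ≥0) : Prop :=
  ∃ Y' : ℝ → Ω → ℝ, (∀ t, Measurable (Y' t)) ∧ IsModification P Y Y' ∧
    ∀ ω, ∃ C : ℝ≥0, HolderWith C α fun t => Y' t ω

/-- `Y` has a modification with almost surely continuous paths. -/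
def HasContinuousModification {S : Type*} [TopologicalSpace S] (P : Measure Ω)
    (Y : ℝ → Ω → S) : Prop :=
  ∃ Y' : ℝ → Ω → S, IsModification P Y Y' ∧ ∀ᵐ ω ∂P, Continuous fun t => Y' t ω

end Definitions

/-- `d(t, t') = O(|t - t'| ^ r)` as `|t - t'| → 0`. -/
def IsBigOPower (d : ℝ → ℝ → ℝ) (r : ℝ) : Prop :=
  (fun p : ℝ × ℝ => d p.1 p.2) =O[comap (fun p : ℝ × ℝ => |p.1 - p.2|) (𝓝 0)]
    (fun p : ℝ × ℝ => |p.1 - p.2| ^ r)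

/-- The step process `X_t = 1(t ≥ U)`. -/
noncomputable def stepProcess {Ω : Type*} (U : Ω → ℝ) : ℝ → Ω → ℝ :=
  fun t ω => if U ω ≤ t then 1 else 0

/-- The process `G_t = 1(t < U) δ₀ + 1(t ≥ U) δ₁` of random measures. -/
noncomputable def stepMixing {Ω : Type*} (U : Ω → ℝ) : ℝ → Ω → ProbabilityMeasure ℝ :=
  fun t ω => if U ω ≤ t then ⟨Measure.dirac 1, inferInstance⟩ else ⟨Measure.dirac 0, inferInstance⟩

end LocalExch

/-! For every `γ > 0` the exponent `r = 1 + γ` exceeds 1, and this forces rigidity. A quantity that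
obeys the triangle inequality and is at most `K |u - v| ^ r` at short range vanishes: cutting an
interval into about `N` steps bounds it by a multiple of `N ^ (1 - r)`, which tends to 0
(`le_zero_of_triangle_of_le_rpow`).

Applied to `E|G_u(A) - G_v(A)|`, this shows that any mixing process is constant up to modification
(`IsMixingProcess.ae_eq_zero`); weak-sense stationarity follows, and constant paths serve as the
Hölder modification. Applied to event probabilities while one tuple of indices is moved linearly to
another, it shows that joint laws at distinct indices do not depend on the indices
(`IsLocallyExchangeable.map_eq_of_finite`), whence exchangeability and stationarity. A mixing
process then exists by de Finetti's theorem (`IsSpreadable.exists_directing_measure`), proved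
through the predictive law of one coordinate given a sequence of others.

For `γ = 0` the subdivision gains nothing. Any mixing process of the step process satisfies
`G_t({1}) = X_t` almost surely (`IsMixingProcess.evalProcess_one_ae_eq`), so a continuous
modification would reproduce a jump on the rationals. -/

namespace LocalExch

/-! ### Subdivision argument for exponents above 1 -/

section Subdivision

/-- A function `D` satisfying the triangle inequality and bounded by `K |u - v| ^ r` with `r > 1`
for nearby points off a finite set does not separate `0` from `1`. -/
theorem le_zero_of_triangle_of_le_rpow {D : ℝ → ℝ → ℝ} {F : Set ℝ} (hF : F.Finite)
    (h0 : 0 ∉ F) (h1 : 1 ∉ F) (htri : ∀ u v w, D u w ≤ D u v + D v w)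
    {K r δ : ℝ} (hK : 0 ≤ K) (hr : 1 < r) (hδ : 0 < δ)
    (hD : ∀ u v, u ∉ F → v ∉ F → |u - v| < δ → D u v ≤ K * |u - v| ^ r) : D 0 1 ≤ 0 := by
  have key : ∀ᶠ N : ℕ in atTop, D 0 1 ≤ ((N : ℝ) + 1) * (K * (2 / (N : ℝ)) ^ r) := by
    have hev : ∀ᶠ N : ℕ in atTop, 2 / (N : ℝ) < δ :=
      (tendsto_const_div_atTop_nhds_zero_nat 2).eventually (gt_mem_nhds hδ)
    filter_upwards [hev, eventually_gt_atTop 0] with N hN hpos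
    have hN0 : (0 : ℝ) < N := by exact_mod_cast hpos
    -- One point off `F` in each open cell of width `1 / N`: points of adjacent cells are within `2
    -- / N`.
    have hex : ∀ j : ℕ, ∃ x, x ∈ Set.Ioo ((j : ℝ) / N) ((j + 1 : ℝ) / N) ∧ x ∉ F := by
      intro j
      have hlt : (j : ℝ) / N < (j + 1 : ℝ) / N := by gcongr; linarith
      obtain ⟨x, hx, hxF⟩ := (Set.Ioo_infinite hlt).exists_notMem_finite hF
      exact ⟨x, hx, hxF⟩
    choose x hx hxF using hex
    have step : ∀ u v, u ∉ F → v ∉ F → |u - v| ≤ 2 / N → D u v ≤ K * (2 / (N : ℝ)) ^ r := by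
      intro u v hu hv huv
      refine (hD u v hu hv (huv.trans_lt hN)).trans ?_
      gcongr
    have e1 : ∀ j : ℕ, ((j : ℝ) + 1) / N = j / N + 1 / N := fun j => add_div _ _ _
    have e2 : (2 : ℝ) / N = 1 / N + 1 / N := by ring
    have hp : (0 : ℝ) < 1 / N := by positivity
    have chain : ∀ j : ℕ, D 0 (x j) ≤ ((j : ℝ) + 1) * (K * (2 / (N : ℝ)) ^ r) := by
      intro j
      induction j with
      | zero =>
        have := hx 0
        rw [Set.mem_Ioo, e1] at this
        simp only [Nat.cast_zero, zero_div, zero_add] at this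
        simpa using step 0 (x 0) h0 (hxF 0) (by rw [abs_le]; constructor <;> linarith)
      | succ j ih =>
        have ha := hx j
        have hb := hx (j + 1)
        rw [Set.mem_Ioo, e1] at ha hb
        push_cast at hb ⊢
        rw [e1] at hb
        have := step (x j) (x (j + 1)) (hxF _) (hxF _) (by
          rw [abs_le]; constructor <;> linarith)
        have := htri 0 (x j) (x (j + 1))
        linarith
    -- The `N` chosen points and the final jump to 1 make `N + 1` jumps.
    obtain ⟨M, rfl⟩ : ∃ M, N = M + 1 := ⟨N - 1, by omega⟩
    have ha := hx M
    have hc := chain M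
    have hs := step (x M) 1 (hxF _) h1 (by
      have h2 : ((M : ℝ) + 1) / ((M + 1 : ℕ) : ℝ) = 1 := by push_cast; field_simp
      rw [Set.mem_Ioo] at ha
      have := e1 M
      rw [h2] at ha this
      rw [abs_le]; constructor <;> linarith)
    have := htri 0 (x M) 1
    push_cast at *
    linarith
  have hlim : Tendsto (fun N : ℕ => ((N : ℝ) + 1) * (K * (2 / (N : ℝ)) ^ r)) atTop (𝓝 0) := by
    have ha : Tendsto (fun N : ℕ => (2 * K * 2 ^ r) * (N : ℝ) ^ (-(r - 1))) atTop (𝓝 0) := by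
      simpa using ((tendsto_rpow_neg_atTop (sub_pos.2 hr)).comp
        tendsto_natCast_atTop_atTop).const_mul (2 * K * 2 ^ r)
    refine squeeze_zero' (Eventually.of_forall fun N => by positivity) ?_ ha
    filter_upwards [eventually_gt_atTop 0] with N hpos
    have hN1 : (1 : ℝ) ≤ N := by exact_mod_cast hpos
    have hN0 : (0 : ℝ) < N := by linarith
    have e : (N : ℝ) ^ (-(r - 1)) = N * ((N : ℝ) ^ r)⁻¹ := by
      rw [show -(r - 1) = 1 + -r by ring, Real.rpow_add hN0, Real.rpow_one, Real.rpow_neg hN0.le]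
    rw [e, Real.div_rpow (by norm_num) hN0.le]
    have : 0 ≤ K * (2 ^ r / (N : ℝ) ^ r) := by positivity
    calc ((N : ℝ) + 1) * (K * (2 ^ r / (N : ℝ) ^ r))
        ≤ (2 * N) * (K * (2 ^ r / (N : ℝ) ^ r)) := by gcongr; linarith
      _ = _ := by ring
  exact ge_of_tendsto hlim key

theorem IsBigOPower.exists_bound {d : ℝ → ℝ → ℝ} (hd : IsPremetric d) {r : ℝ}
    (h : IsBigOPower d r) :
    ∃ C δ : ℝ, 0 ≤ C ∧ 0 < δ ∧ ∀ t t', |t - t'| < δ → d t t' ≤ C * |t - t'| ^ r := by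
  obtain ⟨C, hC, hb⟩ := h.exists_nonneg
  have hb := hb.bound
  rw [eventually_comap] at hb
  obtain ⟨δ, hδ, hball⟩ := Metric.eventually_nhds_iff.1 hb
  refine ⟨C, δ, hC, hδ, fun t t' htt => ?_⟩
  have := hball (y := |t - t'|) (by simpa using htt) (t, t') rfl
  simpa [abs_of_nonneg (hd.nonneg t t'), abs_of_nonneg (Real.rpow_nonneg (abs_nonneg (t - t')) r)]
    using this

end Subdivision

/-! ### Invariance of the joint laws -/

section Laws

variable {Ω 𝒳 : Type*} [MeasurableSpace Ω] [MeasurableSpace 𝒳] {P : Measure Ω}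
  [IsProbabilityMeasure P]

theorem abs_real_sub_le_tvDist {𝒴 : Type*} [MeasurableSpace 𝒴] (μ ν : Measure 𝒴)
    [IsProbabilityMeasure μ] [IsProbabilityMeasure ν] {A : Set 𝒴} (hA : MeasurableSet A) :
    |μ.real A - ν.real A| ≤ tvDist μ ν := by
  refine le_ciSup (f := fun A : {A : Set 𝒴 // MeasurableSet A} => |μ.real A - ν.real A|)
    ⟨1, ?_⟩ ⟨A, hA⟩
  rintro _ ⟨B, rfl⟩
  have h1 : μ.real B ≤ 1 := measureReal_le_one
  have h2 : ν.real B ≤ 1 := measureReal_le_one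
  have h3 : 0 ≤ μ.real B := measureReal_nonneg
  have h4 : 0 ≤ ν.real B := measureReal_nonneg
  rw [abs_le]
  constructor <;> linarith

/-- The definition compares a finite set of indices with its image. Identifying `ι` with the range
of `f` turns this into a comparison of two injective tuples, in which both ends can move. -/
theorem IsLocallyExchangeable.abs_real_map_sub_le {𝒯 : Type*} {X : 𝒯 → Ω → 𝒳}
    (hX : ∀ t, Measurable (X t)) {d : 𝒯 → 𝒯 → ℝ} (h : IsLocallyExchangeable P X d)
    {ι : Type*} [Fintype ι] {f g : ι → 𝒯} (hf : Function.Injective f)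
    (hg : Function.Injective g) {B : Set (ι → 𝒳)} (hB : MeasurableSet B) :
    |(P.map fun ω i => X (f i) ω).real B - (P.map fun ω i => X (g i) ω).real B|
      ≤ ∑ i, d (f i) (g i) := by
  classical
  set T : Finset 𝒯 := Finset.univ.image f with hT
  have hmem : ∀ i, f i ∈ T := fun i => Finset.mem_image_of_mem _ (Finset.mem_univ i)
  let e : ι ≃ T := Equiv.ofBijective (fun i => ⟨f i, hmem i⟩) ⟨fun i j hij => hf (by simpa using hij),
    fun ⟨t, ht⟩ => by
      obtain ⟨i, -, rfl⟩ := Finset.mem_image.1 ht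
      exact ⟨i, rfl⟩⟩
  have he : ∀ i, (e i : 𝒯) = f i := fun i => rfl
  have hTV := h T (g ∘ e.symm) (hg.comp e.symm.injective)
  have hm1 : Measurable (restrictTo X T) := measurable_pi_lambda _ fun t => hX t
  have hm2 : Measurable (reindex X T (g ∘ e.symm)) := measurable_pi_lambda _ fun t => hX _
  have := Measure.isProbabilityMeasure_map (μ := P) hm1.aemeasurable
  have := Measure.isProbabilityMeasure_map (μ := P) hm2.aemeasurable
  let q : (T → 𝒳) → ι → 𝒳 := fun x i => x (e i)
  have hq : Measurable q := measurable_pi_lambda _ fun i => measurable_pi_apply _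
  have hle := (abs_real_sub_le_tvDist (P.map (restrictTo X T))
    (P.map (reindex X T (g ∘ e.symm))) (hq hB)).trans hTV
  have hs : ∑ t : T, d t ((g ∘ e.symm) t) = ∑ i, d (f i) (g i) := by
    rw [← e.sum_comp]
    simp [he]
  rw [hs] at hle
  have e1 : (P.map fun ω i => X (f i) ω) = (P.map (restrictTo X T)).map q := by
    rw [Measure.map_map hq hm1]; rfl
  have e2 : (P.map fun ω i => X (g i) ω) = (P.map (reindex X T (g ∘ e.symm))).map q := by
    rw [Measure.map_map hq hm2]
    congr 1
    ext ω i
    simp [q, reindex]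
  rw [e1, e2, map_measureReal_apply hq hB, map_measureReal_apply hq hB]
  exact hle

/-- Under local exchangeability with a premetric of order `r > 1`, the joint law of finitely many
coordinates does not depend on the (distinct) indices. -/
theorem IsLocallyExchangeable.map_eq_of_finite {X : ℝ → Ω → 𝒳} (hX : ∀ t, Measurable (X t))
    {d : ℝ → ℝ → ℝ} (hd : IsPremetric d) (h : IsLocallyExchangeable P X d) {r : ℝ} (hr : 1 < r)
    (hO : IsBigOPower d r) {ι : Type*} [Finite ι] {f g : ι → ℝ} (hf : Function.Injective f)
    (hg : Function.Injective g) :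
    (P.map fun ω i => X (f i) ω) = P.map fun ω i => X (g i) ω := by
  have := Fintype.ofFinite ι
  obtain ⟨C, δ, hC, hδ, hb⟩ := hO.exists_bound hd
  have hm : ∀ f : ι → ℝ, Measurable fun ω i => X (f i) ω :=
    fun f => measurable_pi_lambda _ fun i => hX _
  have hprob : ∀ f : ι → ℝ, IsProbabilityMeasure (P.map fun ω i => X (f i) ω) :=
    fun f => Measure.isProbabilityMeasure_map (hm f).aemeasurable
  refine Measure.ext fun B hB => ?_
  rw [← measureReal_eq_measureReal_iff, ← sub_eq_zero, ← abs_nonpos_iff]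
  -- Each index travels on a straight line from `f i` to `g i`; the bound applies at times when no
  -- two indices collide.
  let p : ℝ → ι → ℝ := fun u i => f i + u * (g i - f i)
  let D : ℝ → ℝ → ℝ := fun u v => |(P.map fun ω i => X (p u i) ω).real B -
    (P.map fun ω i => X (p v i) ω).real B|
  have hD01 : D 0 1 = |(P.map fun ω i => X (f i) ω).real B -
      (P.map fun ω i => X (g i) ω).real B| := by simp [D, p]
  rw [← hD01]
  set L : ℝ := ∑ i, |f i - g i| with hL
  have hL0 : 0 ≤ L := Finset.sum_nonneg fun i _ => abs_nonneg _
  have hLi : ∀ i, |f i - g i| ≤ L := fun i =>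
    Finset.single_le_sum (f := fun i => |f i - g i|) (fun i _ => abs_nonneg _) (Finset.mem_univ i)
  have hpd : ∀ u v i, |p u i - p v i| = |f i - g i| * |u - v| := by
    intro u v i
    rw [← abs_mul, ← abs_neg]
    congr 1
    simp only [p]; ring
  -- `F` is the set of collision times. The `+ 1` keeps the radius meaningful when `L = 0`.
  refine le_zero_of_triangle_of_le_rpow (D := D) (F := {u | ¬ Function.Injective (p u)})
    (K := ∑ i : ι, C * |f i - g i| ^ r) (r := r) (δ := δ / (L + 1)) ?_ ?_ ?_
    (fun u v w => abs_sub_le _ _ _)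
    (Finset.sum_nonneg fun i _ => by positivity) hr (by positivity) ?_
  -- Two of the lines start at different points, so they meet at most once, at an explicit quotient;
  -- parallel ones never meet.
  · refine (Set.finite_range fun ij : ι × ι =>
      (f ij.2 - f ij.1) / ((g ij.1 - f ij.1) - (g ij.2 - f ij.2))).subset ?_
    intro u hu
    simp only [Set.mem_ofPred_eq, Function.Injective, not_forall] at hu
    obtain ⟨i, j, hij, hne⟩ := hu
    have hij' : u * ((g i - f i) - (g j - f j)) = f j - f i := by
      simp only [p] at hij; linarith
    refine ⟨(i, j), ?_⟩
    have hz : (g i - f i) - (g j - f j) ≠ 0 := by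
      intro hz
      rw [hz, mul_zero] at hij'
      exact hne (hf (by linarith))
    simp only
    rw [div_eq_iff hz]
    exact hij'.symm
  · simpa [p] using hf
  · simpa [p] using hg
  · intro u v hu hv huv
    simp only [Set.mem_ofPred_eq, not_not] at hu hv
    refine (h.abs_real_map_sub_le hX hu hv hB).trans ?_
    rw [Finset.sum_mul]
    refine Finset.sum_le_sum fun i _ => ?_
    have hlt : |p u i - p v i| < δ := by
      rw [hpd]
      calc |f i - g i| * |u - v| ≤ L * |u - v| := by gcongr; exact hLi i
        _ ≤ (L + 1) * |u - v| := by gcongr; linarith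
        _ < (L + 1) * (δ / (L + 1)) := by gcongr
        _ = δ := by field_simp
    refine (hb _ _ hlt).trans_eq ?_
    rw [hpd, Real.mul_rpow (abs_nonneg _) (abs_nonneg _)]
    ring

/-- Invariance of the joint laws passes from finite to arbitrary families of indices. -/
theorem map_eq_of_forall_finite {X : ℝ → Ω → 𝒳} (hX : ∀ t, Measurable (X t))
    (h : ∀ {ι : Type} [Finite ι] {f g : ι → ℝ}, Function.Injective f → Function.Injective g →
      (P.map fun ω i => X (f i) ω) = P.map fun ω i => X (g i) ω)
    {ι : Type} {f g : ι → ℝ} (hf : Function.Injective f) (hg : Function.Injective g) :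
    (P.map fun ω i => X (f i) ω) = P.map fun ω i => X (g i) ω := by
  rw [map_eq_iff_forall_finset_map_restrict_eq (X := fun i ω => X (f i) ω)
    (Y := fun i ω => X (g i) ω)]
  · intro I
    exact h (hf.comp Subtype.val_injective) (hg.comp Subtype.val_injective)
  all_goals exact (measurable_pi_lambda _ fun i => hX _).aemeasurable

end Laws
end LocalExch

namespace LocalExch

/-! ### Almost sure equality and measurability of random measures -/

section RandomMeasures

variable {Ω 𝒳 : Type*} [MeasurableSpace Ω] [MeasurableSpace 𝒳] {P : Measure Ω}
  [IsProbabilityMeasure P]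

/-- Two random probability measures on a countably generated space that agree almost surely on
each measurable set agree almost surely. -/
theorem ae_eq_of_forall_measure_ae_eq [MeasurableSpace.CountablyGenerated 𝒳]
    {μ ν : Ω → ProbabilityMeasure 𝒳} (hμ : Measurable μ) (hν : Measurable ν)
    (h : ∀ A, MeasurableSet A → ∀ᵐ ω ∂P, (μ ω : Measure 𝒳) A = (ν ω : Measure 𝒳) A) :
    μ =ᵐ[P] ν := by
  let κ : Kernel Ω 𝒳 := ⟨fun ω => (μ ω : Measure 𝒳), measurable_subtype_coe.comp hμ⟩
  let η : Kernel Ω 𝒳 := ⟨fun ω => (ν ω : Measure 𝒳), measurable_subtype_coe.comp hν⟩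
  have : IsMarkovKernel κ := ⟨fun ω => (μ ω).2⟩
  have : IsMarkovKernel η := ⟨fun ω => (ν ω).2⟩
  -- The null set depends on `A`; comparing the joint measures on rectangles and using uniqueness of
  -- disintegration gives a single null set.
  have hκη : κ =ᵐ[P] η := by
    refine Kernel.ae_eq_of_compProd_eq ?_
    refine Measure.ext_prod fun {s t} hs ht => ?_
    rw [Measure.compProd_apply_prod hs ht, Measure.compProd_apply_prod hs ht]
    exact lintegral_congr_ae (ae_restrict_of_ae (h t ht))
  filter_upwards [hκη] with ω hω
  exact Subtype.ext hω

theorem measurable_pi_probabilityMeasure {ι : Type*} [Fintype ι] :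
    Measurable fun μ : ι → ProbabilityMeasure 𝒳 => Measure.pi fun i => (μ i : Measure 𝒳) := by
  refine Measurable.measure_of_isPiSystem_of_isProbabilityMeasure generateFrom_pi.symm
    isPiSystem_pi ?_
  rintro _ ⟨A, hA, rfl⟩
  simp only [Measure.pi_pi]
  exact Finset.measurable_prod _ fun i _ =>
    (Measure.measurable_coe (hA i trivial)).comp
      (measurable_subtype_coe.comp (measurable_pi_apply i))

/-- Equality in the Cauchy–Schwarz inequality for `[0, 1]`-valued functions. -/
theorem ae_eq_of_lintegral_mul_eq {f g : Ω → ENNReal} (hf : Measurable f) (hg : Measurable g)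
    (hf1 : ∀ ω, f ω ≤ 1) (hg1 : ∀ ω, g ω ≤ 1)
    (h1 : ∫⁻ ω, f ω * f ω ∂P = ∫⁻ ω, g ω * g ω ∂P)
    (h2 : ∫⁻ ω, g ω * f ω ∂P = ∫⁻ ω, g ω * g ω ∂P) : f =ᵐ[P] g := by
  have hle : ∀ {a b : ENNReal}, a ≤ 1 → b ≤ 1 → a * b < ⊤ := fun ha hb =>
    ENNReal.mul_lt_top (ha.trans_lt ENNReal.one_lt_top) (hb.trans_lt ENNReal.one_lt_top)
  have hint : ∀ {a b : Ω → ENNReal}, Measurable a → Measurable b → (∀ ω, a ω ≤ 1) →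
      (∀ ω, b ω ≤ 1) → Integrable (fun ω => (a ω * b ω).toReal) P := by
    intro a b ha hb ha1 hb1
    refine integrable_toReal_of_lintegral_ne_top (ha.mul hb).aemeasurable ?_
    refine ((lintegral_mono fun ω => mul_le_mul' (ha1 ω) (hb1 ω)).trans_lt ?_).ne
    simp
  have heq : ∀ {a b : Ω → ENNReal}, Measurable a → Measurable b → (∀ ω, a ω ≤ 1) →
      (∀ ω, b ω ≤ 1) → ∫ ω, (a ω * b ω).toReal ∂P = (∫⁻ ω, a ω * b ω ∂P).toReal :=
    fun ha hb ha1 hb1 => integral_toReal (ha.mul hb).aemeasurable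
      (ae_of_all _ fun ω => hle (ha1 ω) (hb1 ω))
  -- The two moment identities make `E(f - g)²` vanish once the square is expanded.
  have hsq : (fun ω => ((f ω).toReal - (g ω).toReal) ^ 2) =
      fun ω => (f ω * f ω).toReal - 2 * (g ω * f ω).toReal + (g ω * g ω).toReal := by
    ext ω
    simp only [ENNReal.toReal_mul]
    ring
  have hI : Integrable (fun ω => ((f ω).toReal - (g ω).toReal) ^ 2) P := by
    rw [hsq]
    exact ((hint hf hf hf1 hf1).sub ((hint hg hf hg1 hf1).const_mul 2)).add (hint hg hg hg1 hg1)
  have h0 : ∫ ω, ((f ω).toReal - (g ω).toReal) ^ 2 ∂P = 0 := by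
    rw [hsq, integral_add (f := fun ω => (f ω * f ω).toReal - 2 * (g ω * f ω).toReal)
      ((hint hf hf hf1 hf1).sub ((hint hg hf hg1 hf1).const_mul 2))
      (hint hg hg hg1 hg1), integral_sub (hint hf hf hf1 hf1)
      ((hint hg hf hg1 hf1).const_mul 2), integral_const_mul, heq hf hf hf1 hf1,
      heq hg hf hg1 hf1, heq hg hg hg1 hg1, h1, h2]
    ring
  rw [integral_eq_zero_iff_of_nonneg (fun ω => sq_nonneg _) hI] at h0
  filter_upwards [h0] with ω hω
  have : (f ω).toReal = (g ω).toReal := by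
    simpa [sub_eq_zero] using hω
  exact (ENNReal.toReal_eq_toReal_iff' ((hf1 ω).trans_lt ENNReal.one_lt_top).ne
    ((hg1 ω).trans_lt ENNReal.one_lt_top).ne).1 this

end RandomMeasures

/-! ### De Finetti's theorem through predictive laws -/

section DeFinetti

variable {𝒯 Ω 𝒳 : Type*} [MeasurableSpace Ω] [MeasurableSpace 𝒳] {P : Measure Ω}
  [IsProbabilityMeasure P] {X : 𝒯 → Ω → 𝒳}

/-- The joint law of a sequence of coordinates of `X` does not depend on the (distinct) indices. -/
def IsSpreadable (P : Measure Ω) (X : 𝒯 → Ω → 𝒳) : Prop :=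
  ∀ f g : ℕ → 𝒯, Function.Injective f → Function.Injective g →
    (P.map fun ω n => X (f n) ω) = P.map fun ω n => X (g n) ω

/-- The sequence `t, s 0, s 1, …`. -/
def consSeq (t : 𝒯) (s : ℕ → 𝒯) : ℕ → 𝒯
  | 0 => t
  | n + 1 => s n

theorem consSeq_injective {t : 𝒯} {s : ℕ → 𝒯} (hs : Function.Injective s)
    (ht : t ∉ Set.range s) : Function.Injective (consSeq t s) := by
  rintro (_ | m) (_ | n) h
  · rfl
  · exact absurd ⟨n, h.symm⟩ ht
  · exact absurd ⟨m, h⟩ ht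
  · exact congrArg _ (hs h)

theorem notMem_range_consSeq {t t' : 𝒯} {s : ℕ → 𝒯} (h : t' ≠ t) (ht' : t' ∉ Set.range s) :
    t' ∉ Set.range (consSeq t s) := by
  rintro ⟨_ | n, hn⟩
  · exact h hn.symm
  · exact ht' ⟨n, hn⟩

/-- `κ` is a version of the conditional law of `X t` given `X (s 0), X (s 1), …`, for all sequences
`s` of distinct indices other than `t`. -/
def IsPredictiveKernel (P : Measure Ω) (X : 𝒯 → Ω → 𝒳) (κ : Kernel (ℕ → 𝒳) 𝒳) : Prop :=
  ∀ (s : ℕ → 𝒯) (t : 𝒯), Function.Injective s → t ∉ Set.range s →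
    ∀ (A : Set 𝒳), MeasurableSet A → ∀ g : (ℕ → 𝒳) → ENNReal, Measurable g →
      ∫⁻ ω, g (fun n => X (s n) ω) * A.indicator 1 (X t ω) ∂P =
        ∫⁻ ω, g (fun n => X (s n) ω) * κ (fun n => X (s n) ω) A ∂P

/-- The pair formed by a sequence of coordinates and one further coordinate has the same law for all
choices of distinct indices, so one disintegration kernel serves them all. -/
theorem IsSpreadable.exists_isPredictiveKernel [StandardBorelSpace 𝒳] [Infinite 𝒯]
    (hX : ∀ t, Measurable (X t)) (h : IsSpreadable P X) :
    ∃ κ : Kernel (ℕ → 𝒳) 𝒳, IsMarkovKernel κ ∧ IsPredictiveKernel P X κ := by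
  have hΩ : Nonempty Ω := P.nonempty_of_neZero
  have : Nonempty 𝒳 := hΩ.map (X (Infinite.natEmbedding 𝒯 0))
  let q : (ℕ → 𝒳) → (ℕ → 𝒳) × 𝒳 := fun x => (fun n => x (n + 1), x 0)
  have hq : Measurable q := by fun_prop
  have hm : ∀ f : ℕ → 𝒯, Measurable fun ω n => X (f n) ω :=
    fun f => measurable_pi_lambda _ fun i => hX _
  let ρ : Measure ((ℕ → 𝒳) × 𝒳) := (P.map fun ω n => X (Infinite.natEmbedding 𝒯 n) ω).map q
  have : IsFiniteMeasure ρ := inferInstance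
  refine ⟨ρ.condKernel, inferInstance, fun s t hs ht A hA g hg => ?_⟩
  have hρ : ρ = P.map fun ω => ((fun n => X (s n) ω), X t ω) := by
    simp only [ρ]
    rw [h _ _ (Infinite.natEmbedding 𝒯).injective (consSeq_injective hs ht),
      Measure.map_map hq (hm _)]
    rfl
  have hpair : Measurable fun ω => ((fun n => X (s n) ω), X t ω) := (hm s).prodMk (hX t)
  have hfst : ρ.fst = P.map fun ω n => X (s n) ω := by
    rw [Measure.fst, hρ, Measure.map_map measurable_fst hpair]; rfl
  have hF : Measurable fun p : (ℕ → 𝒳) × 𝒳 => g p.1 * A.indicator 1 p.2 :=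
    (hg.comp measurable_fst).mul ((measurable_one.indicator hA).comp measurable_snd)
  calc ∫⁻ ω, g (fun n => X (s n) ω) * A.indicator 1 (X t ω) ∂P
      = ∫⁻ p, g p.1 * A.indicator 1 p.2 ∂ρ := by rw [hρ, lintegral_map hF hpair]
    _ = ∫⁻ x, ∫⁻ y, g x * A.indicator 1 y ∂ρ.condKernel x ∂ρ.fst :=
        (Measure.lintegral_condKernel hF).symm
    _ = ∫⁻ x, g x * ρ.condKernel x A ∂ρ.fst := by
        refine lintegral_congr fun x => ?_
        rw [lintegral_const_mul _ (measurable_one.indicator hA), lintegral_indicator_one hA]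
    _ = _ := by
        rw [hfst]
        exact lintegral_map (hg.mul (Kernel.measurable_coe _ hA)) (hm s)

variable {κ : Kernel (ℕ → 𝒳) 𝒳} [IsMarkovKernel κ]

/-- The predictive law is almost surely the same for a sequence of indices and a subsequence. -/
theorem IsPredictiveKernel.ae_eq_subsequence [MeasurableSpace.CountablyGenerated 𝒳] [Uncountable 𝒯]
    (hX : ∀ t, Measurable (X t)) (h : IsSpreadable P X) (hκ : IsPredictiveKernel P X κ)
    {s : ℕ → 𝒯} (hs : Function.Injective s) {r : ℕ → ℕ} (hr : Function.Injective r) :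
    ∀ᵐ ω ∂P, κ (fun n => X (s n) ω) = κ (fun n => X (s (r n)) ω) := by
  -- Uncountability supplies a fresh index, whose coordinate can be predicted from both sequences.
  obtain ⟨t, ht⟩ : ∃ t, t ∉ Set.range s := by
    by_contra! hall
    exact not_countable (Set.countable_univ_iff.1
      ((Set.countable_range s).mono fun t _ => hall t))
  have ht' : t ∉ Set.range (s ∘ r) := fun ⟨n, hn⟩ => ht ⟨r n, hn⟩
  have hm : ∀ f : ℕ → 𝒯, Measurable fun ω n => X (f n) ω :=
    fun f => measurable_pi_lambda _ fun i => hX _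
  let μ : (ℕ → 𝒯) → Ω → ProbabilityMeasure 𝒳 := fun f ω => ⟨κ fun n => X (f n) ω, inferInstance⟩
  have hμ : ∀ f, Measurable (μ f) := fun f => (κ.measurable.comp (hm f)).subtype_mk
  have key : μ s =ᵐ[P] μ (s ∘ r) := by
    refine ae_eq_of_forall_measure_ae_eq (hμ _) (hμ _) fun A hA => ?_
    have hκA : Measurable fun x => κ x A := Kernel.measurable_coe κ hA
    refine ae_eq_of_lintegral_mul_eq (hκA.comp (hm s)) (hκA.comp (hm (s ∘ r)))
      (fun _ => prob_le_one) (fun _ => prob_le_one) ?_ ?_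
    -- Second moments agree because both sequences have the same law.
    · have e : ∀ f : ℕ → 𝒯, ∫⁻ ω, κ (fun n => X (f n) ω) A * κ (fun n => X (f n) ω) A ∂P =
          ∫⁻ x, κ x A * κ x A ∂(P.map fun ω n => X (f n) ω) := fun f =>
        (lintegral_map (hκA.mul hκA) (hm f)).symm
      exact (e s).trans ((by rw [h s (s ∘ r) hs (hs.comp hr)] : _ = _).trans (e (s ∘ r)).symm)
    -- The prediction from the subsequence is a function of either sequence; testing the event `X_t
    -- ∈ A` against it in both ways gives the cross moment.
    · have e1 := hκ s t hs ht A hA (fun x => κ (fun n => x (r n)) A)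
        (hκA.comp (measurable_pi_lambda _ fun n => measurable_pi_apply _))
      have e2 := hκ (s ∘ r) t (hs.comp hr) ht' A hA (fun x => κ x A) hκA
      exact e1.symm.trans e2
  filter_upwards [key] with ω hω
  exact congrArg Subtype.val hω

/-- Given a sequence of coordinates, finitely many other coordinates are conditionally
independent with the predictive law. -/
theorem IsPredictiveKernel.lintegral_mul_prod_indicator [MeasurableSpace.CountablyGenerated 𝒳]
    [Uncountable 𝒯] (hX : ∀ t, Measurable (X t)) (h : IsSpreadable P X)
    (hκ : IsPredictiveKernel P X κ) {A : 𝒯 → Set 𝒳} (hA : ∀ t, MeasurableSet (A t))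
    (T : Finset 𝒯) {s : ℕ → 𝒯} (hs : Function.Injective s) (hT : ∀ t ∈ T, t ∉ Set.range s)
    {g : (ℕ → 𝒳) → ENNReal} (hg : Measurable g) :
    ∫⁻ ω, g (fun n => X (s n) ω) * ∏ t ∈ T, (A t).indicator 1 (X t ω) ∂P =
      ∫⁻ ω, g (fun n => X (s n) ω) * ∏ t ∈ T, κ (fun n => X (s n) ω) (A t) ∂P := by
  classical
  induction T using Finset.induction_on generalizing s g with
  | empty => simp
  | insert t T htT ih =>
    have ht : t ∉ Set.range s := hT t (Finset.mem_insert_self _ _)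
    have hT' : ∀ t' ∈ T, t' ∉ Set.range s := fun t' h' => hT t' (Finset.mem_insert_of_mem h')
    have hs' := consSeq_injective hs ht
    have hκA : ∀ t, Measurable fun x => κ x (A t) := fun t => Kernel.measurable_coe κ (hA t)
    -- Prepend `t` to the sequence, so that its indicator joins the test function. By `h3` the
    -- predictive law is unaffected by the extra entry, and `h2` then integrates out `X_t`.
    have h1 := ih hs' (fun t' h' => notMem_range_consSeq (fun e => htT (e ▸ h')) (hT' t' h'))
      (g := fun x => g (fun n => x (n + 1)) * (A t).indicator 1 (x 0))
      ((hg.comp (measurable_pi_lambda _ fun n => measurable_pi_apply _)).mul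
        ((measurable_one.indicator (hA t)).comp (measurable_pi_apply 0)))
    have h2 := hκ s t hs ht (A t) (hA t)
      (fun x => g x * ∏ t ∈ T, κ x (A t)) (hg.mul (Finset.measurable_prod _ fun t _ => hκA t))
    have h3 := hκ.ae_eq_subsequence hX h hs' (r := Nat.succ) Nat.succ_injective
    simp only [Finset.prod_insert htT]
    calc ∫⁻ ω, g (fun n => X (s n) ω) *
          ((A t).indicator 1 (X t ω) * ∏ i ∈ T, (A i).indicator 1 (X i ω)) ∂P
        = ∫⁻ ω, g (fun n => X (s n) ω) * (A t).indicator 1 (X t ω) *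
            ∏ i ∈ T, κ (fun n => X (consSeq t s n) ω) (A i) ∂P := by
          simp only [← mul_assoc]; exact h1
      _ = ∫⁻ ω, (g (fun n => X (s n) ω) * ∏ i ∈ T, κ (fun n => X (s n) ω) (A i)) *
            (A t).indicator 1 (X t ω) ∂P := by
          refine lintegral_congr_ae ?_
          filter_upwards [h3] with ω hω
          have hω' : κ (fun n => X (consSeq t s n) ω) = κ (fun n => X (s n) ω) := hω
          simp only [hω']
          ring
      _ = _ := by
          rw [h2]
          refine lintegral_congr fun ω => ?_
          ring

/-- De Finetti's theorem. -/
theorem IsSpreadable.exists_directing_measure [StandardBorelSpace 𝒳] [Uncountable 𝒯]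
    (hX : ∀ t, Measurable (X t)) (h : IsSpreadable P X) :
    ∃ ν : Ω → ProbabilityMeasure 𝒳, Measurable ν ∧
      ∀ (T : Finset 𝒯) (C : Set (ProbabilityMeasure 𝒳)), MeasurableSet C →
        ∀ B : Set (T → 𝒳), MeasurableSet B →
          P (ν ⁻¹' C ∩ restrictTo X T ⁻¹' B) =
            ∫⁻ ω in ν ⁻¹' C, Measure.pi (fun _ : T => (ν ω : Measure 𝒳)) B ∂P := by
  classical
  have : Infinite 𝒯 := inferInstance
  obtain ⟨κ, _, hκ⟩ := h.exists_isPredictiveKernel hX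
  have hm : ∀ f : ℕ → 𝒯, Measurable fun ω n => X (f n) ω :=
    fun f => measurable_pi_lambda _ fun i => hX _
  let k : (ℕ → 𝒳) → ProbabilityMeasure 𝒳 := fun x => ⟨κ x, inferInstance⟩
  have hk : Measurable k := κ.measurable.subtype_mk
  let s := Infinite.natEmbedding 𝒯
  let ν : Ω → ProbabilityMeasure 𝒳 := fun ω => k fun n => X (s n) ω
  have hν : Measurable ν := hk.comp (hm _)
  refine ⟨ν, hν, fun T C hC B hB => ?_⟩
  have hS : MeasurableSet (ν ⁻¹' C) := hν hC
  have hr : Measurable (restrictTo X T) := measurable_pi_lambda _ fun t => hX t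
  have hpi : Measurable fun ω => Measure.pi fun _ : T => (ν ω : Measure 𝒳) :=
    measurable_pi_probabilityMeasure.comp (measurable_pi_lambda _ fun _ => hν)
  -- The conditioning sequence may meet `T`; a tail avoids it and almost surely has the same
  -- predictive law.
  obtain ⟨m, hmT⟩ : ∃ m, ∀ n, m ≤ n → s n ∉ T := by
    obtain ⟨m, hm⟩ := (T.finite_toSet.preimage s.injective.injOn).bddAbove
    exact ⟨m + 1, fun n hn hnT => by have := hm (show n ∈ s ⁻¹' T from hnT); omega⟩
  let s' : ℕ → 𝒯 := fun n => s (n + m)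
  have hs' : Function.Injective s' := s.injective.comp (add_left_injective m)
  have hνs' : ∀ᵐ ω ∂P, ν ω = k fun n => X (s' n) ω := by
    filter_upwards [hκ.ae_eq_subsequence hX h s.injective (add_left_injective m)] with ω hω
    exact Subtype.ext hω
  have hpi_rect : ∀ A : T → Set 𝒳, (∀ t, MeasurableSet (A t)) →
      P (ν ⁻¹' C ∩ restrictTo X T ⁻¹' Set.univ.pi A) =
        ∫⁻ ω in ν ⁻¹' C, Measure.pi (fun _ : T => (ν ω : Measure 𝒳)) (Set.univ.pi A) ∂P := by
    intro A hA
    let A' : 𝒯 → Set 𝒳 := fun t => if ht : t ∈ T then A ⟨t, ht⟩ else Set.univ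
    have hA' : ∀ t, MeasurableSet (A' t) := fun t => by
      simp only [A']; split_ifs
      exacts [hA _, MeasurableSet.univ]
    have hAA : ∀ t : T, A' t = A t := fun t => by simp [A']
    have hfun := hκ.lintegral_mul_prod_indicator hX h hA' T hs'
      (fun t ht ⟨n, hn⟩ => hmT (n + m) (Nat.le_add_left _ _) ((show s (n + m) = t from hn) ▸ ht))
      (g := (k ⁻¹' C).indicator 1) (measurable_one.indicator (hk hC))
    rw [← lintegral_indicator_one (hS.inter (hr (MeasurableSet.univ_pi hA))),
      ← lintegral_indicator hS]
    have hl : ∫⁻ ω, (ν ⁻¹' C ∩ restrictTo X T ⁻¹' Set.univ.pi A).indicator 1 ω ∂P =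
        ∫⁻ ω, (k ⁻¹' C).indicator 1 (fun n => X (s' n) ω) *
          ∏ t ∈ T, (A' t).indicator 1 (X t ω) ∂P := by
      refine lintegral_congr_ae ?_
      filter_upwards [hνs'] with ω hω
      rw [Set.inter_indicator_one, Pi.mul_apply]
      congr 1
      · simp only [Set.indicator, Set.mem_preimage, hω]
        rfl
      · rw [← Finset.prod_coe_sort]
        simp only [hAA, Set.indicator, Set.mem_preimage, Set.mem_univ_pi, Pi.one_apply,
          Finset.prod_ite_zero, Finset.prod_const_one, restrictTo, Finset.mem_univ, true_implies]
    have hrr : ∫⁻ ω, (ν ⁻¹' C).indicator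
        (fun ω => Measure.pi (fun _ : T => (ν ω : Measure 𝒳)) (Set.univ.pi A)) ω ∂P =
        ∫⁻ ω, (k ⁻¹' C).indicator 1 (fun n => X (s' n) ω) *
          ∏ t ∈ T, κ (fun n => X (s' n) ω) (A' t) ∂P := by
      refine lintegral_congr_ae ?_
      filter_upwards [hνs'] with ω hω
      rw [← Finset.prod_coe_sort]
      simp only [hAA, Set.indicator, Set.mem_preimage, Measure.pi_pi, hω, Pi.one_apply]
      split_ifs
      · rw [one_mul]; rfl
      · rw [zero_mul]
    rw [hl, hrr, hfun]
  have hmeas : (P.restrict (ν ⁻¹' C)).map (restrictTo X T) =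
      (P.restrict (ν ⁻¹' C)).bind fun ω => Measure.pi fun _ : T => (ν ω : Measure 𝒳) := by
    refine ext_of_generate_finite _ generateFrom_pi.symm isPiSystem_pi ?_ ?_
    · rintro _ ⟨A, hA, rfl⟩
      have hA' : ∀ t, MeasurableSet (A t) := fun t => hA t trivial
      have hAm := MeasurableSet.univ_pi hA'
      rw [Measure.map_apply hr hAm, Measure.restrict_apply (hr hAm),
        Measure.bind_apply hAm hpi.aemeasurable, Set.inter_comm, hpi_rect A hA']
    · rw [Measure.map_apply hr .univ, Measure.bind_apply .univ hpi.aemeasurable]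
      simp
  have := congrArg (fun μ : Measure (T → 𝒳) => μ B) hmeas
  rwa [Measure.map_apply hr hB, Measure.restrict_apply (hr hB),
    Measure.bind_apply hB hpi.aemeasurable, Set.inter_comm] at this

end DeFinetti
end LocalExch

namespace LocalExch

/-! ### Mixing processes: existence and constancy -/

section Mixing

variable {𝒯 Ω 𝒳 : Type*} [MeasurableSpace Ω] [MeasurableSpace 𝒳] {P : Measure Ω}
  [IsProbabilityMeasure P]

theorem sigmaOf_le {G : 𝒯 → Ω → ProbabilityMeasure 𝒳} (hG : ∀ t, Measurable (G t)) :
    sigmaOf G ≤ ‹MeasurableSpace Ω› :=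
  iSup_le fun t => (hG t).comap_le

omit [MeasurableSpace Ω] in
theorem measurable_sigmaOf (G : 𝒯 → Ω → ProbabilityMeasure 𝒳) (t : 𝒯) :
    Measurable[sigmaOf G] (G t) :=
  (comap_measurable (G t)).mono (le_iSup (fun t => MeasurableSpace.comap (G t) inferInstance) t)
    le_rfl

theorem measurable_real_apply {A : Set 𝒳} (hA : MeasurableSet A) :
    Measurable fun μ : ProbabilityMeasure 𝒳 => (μ : Measure 𝒳).real A :=
  ((Measure.measurable_coe hA).comp measurable_subtype_coe).ennreal_toReal

theorem measurable_evalProcess {G : 𝒯 → Ω → ProbabilityMeasure 𝒳} (hG : ∀ t, Measurable (G t))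
    {A : Set 𝒳} (hA : MeasurableSet A) (t : 𝒯) : Measurable (evalProcess G A t) :=
  (measurable_real_apply hA).comp (hG t)

theorem memLp_evalProcess {G : 𝒯 → Ω → ProbabilityMeasure 𝒳} (hG : ∀ t, Measurable (G t))
    {A : Set 𝒳} (hA : MeasurableSet A) (t : 𝒯) (p : ENNReal) : MemLp (evalProcess G A t) p P :=
  MemLp.of_bound (measurable_evalProcess hG hA t).aestronglyMeasurable 1 <| ae_of_all _ fun ω => by
    simp only [evalProcess, Real.norm_eq_abs, abs_of_nonneg measureReal_nonneg]
    exact measureReal_le_one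

theorem integrable_evalProcess {G : 𝒯 → Ω → ProbabilityMeasure 𝒳} (hG : ∀ t, Measurable (G t))
    {A : Set 𝒳} (hA : MeasurableSet A) (t : 𝒯) : Integrable (evalProcess G A t) P :=
  memLp_one_iff_integrable.1 (memLp_evalProcess hG hA t 1)

/-- The directing measure, taken at all times, works: its increments vanish and it alone generates
the σ-algebra. -/
theorem IsSpreadable.exists_mixing [StandardBorelSpace 𝒳] [Uncountable 𝒯]
    {X : 𝒯 → Ω → 𝒳} (hX : ∀ t, Measurable (X t)) {d : 𝒯 → 𝒯 → ℝ} (hd : IsPremetric d)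
    (h : IsSpreadable P X) : ∃ G, IsMixingProcess P X d G := by
  obtain ⟨ν, hν, hlaw⟩ := h.exists_directing_measure hX
  have : Nonempty 𝒯 := inferInstance
  refine ⟨fun _ => ν, fun _ => hν, fun T B hB => ?_, fun t t' A _ => by simpa using hd.nonneg t t'⟩
  have hσ : sigmaOf (fun _ : 𝒯 => ν) = MeasurableSpace.comap ν inferInstance := ciSup_const
  have hr : Measurable (restrictTo X T) := measurable_pi_lambda _ fun t => hX t
  have hF : Measurable fun μ : ProbabilityMeasure 𝒳 =>
      Measure.pi (fun _ : T => (μ : Measure 𝒳)) B :=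
    (Measure.measurable_coe hB).comp
      (measurable_pi_probabilityMeasure.comp (measurable_pi_lambda _ fun _ => measurable_id))
  have hint : Integrable (fun ω => (Measure.pi fun _ : T => (ν ω : Measure 𝒳)).real B) P :=
    Integrable.of_bound ((hF.comp hν).ennreal_toReal).aestronglyMeasurable 1 <|
      ae_of_all _ fun ω => by
        rw [Real.norm_eq_abs, abs_of_nonneg measureReal_nonneg]
        exact measureReal_le_one
  refine (ae_eq_condExp_of_forall_setIntegral_eq (sigmaOf_le fun _ => hν)
    ((integrable_const 1).indicator (hr hB)) (fun s _ _ => hint.integrableOn) ?_ ?_).symm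
  · intro S hS _
    rw [hσ] at hS
    obtain ⟨C, hC, rfl⟩ := hS
    rw [integral_indicator (hr hB), Measure.restrict_restrict (hr hB), setIntegral_const,
      smul_eq_mul, mul_one, Set.inter_comm, measureReal_def, hlaw T C hC B hB]
    exact integral_toReal (hF.comp hν).aemeasurable (ae_of_all _ fun ω => measure_lt_top _ _)
  · refine (Measurable.stronglyMeasurable ?_).aestronglyMeasurable
    rw [hσ]
    exact hF.ennreal_toReal.comp (comap_measurable ν)

/-- The defining identity of a mixing process in integrated form, on rectangles. -/
theorem IsMixingProcess.setIntegral_prod {X : 𝒯 → Ω → 𝒳} (hX : ∀ t, Measurable (X t))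
    {d : 𝒯 → 𝒯 → ℝ} {G : 𝒯 → Ω → ProbabilityMeasure 𝒳} (hG : IsMixingProcess P X d G)
    (T : Finset 𝒯) {A : 𝒯 → Set 𝒳} (hA : ∀ t, MeasurableSet (A t)) {S : Set Ω}
    (hS : MeasurableSet[sigmaOf G] S) :
    ∫ ω in S, ∏ t ∈ T, evalProcess G (A t) t ω ∂P = P.real ({ω | ∀ t ∈ T, X t ω ∈ A t} ∩ S) := by
  have hB : MeasurableSet (Set.univ.pi fun t : T => A t) := MeasurableSet.univ_pi fun t => hA t
  have hr : Measurable (restrictTo X T) := measurable_pi_lambda _ fun t => hX t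
  have hle := sigmaOf_le hG.measurable
  have hset : {ω | ∀ t ∈ T, X t ω ∈ A t} = restrictTo X T ⁻¹' Set.univ.pi fun t : T => A t := by
    ext ω
    simp [restrictTo]
  have h1 := setIntegral_condExp hle ((integrable_const (μ := P) (1 : ℝ)).indicator (hr hB)) hS
  rw [integral_indicator (hr hB), Measure.restrict_restrict (hr hB), setIntegral_const,
    smul_eq_mul, mul_one] at h1
  rw [hset, ← h1]
  refine integral_congr_ae (ae_restrict_of_ae ?_)
  filter_upwards [hG.condLaw T _ hB] with ω hω
  rw [hω, measureReal_def, Measure.pi_pi, ENNReal.toReal_prod, ← Finset.prod_coe_sort]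
  rfl

/-- If `d` is of order `r > 1` then every mixing process is constant up to modification. -/
theorem IsMixingProcess.ae_eq_zero [MeasurableSpace.CountablyGenerated 𝒳] {X : ℝ → Ω → 𝒳}
    {d : ℝ → ℝ → ℝ} (hd : IsPremetric d) {r : ℝ} (hr : 1 < r) (hO : IsBigOPower d r)
    {G : ℝ → Ω → ProbabilityMeasure 𝒳} (hG : IsMixingProcess P X d G) (t : ℝ) :
    G t =ᵐ[P] G 0 := by
  obtain ⟨C, δ, hC, hδ, hb⟩ := hO.exists_bound hd
  refine ae_eq_of_forall_measure_ae_eq (hG.measurable t) (hG.measurable 0) fun A hA => ?_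
  have hI := integrable_evalProcess (P := P) hG.measurable hA
  let D : ℝ → ℝ → ℝ := fun u v =>
    ∫ ω, |(evalProcess G A (t * u) ω) - evalProcess G A (t * v) ω| ∂P
  have hD : D 0 1 ≤ 0 := by
    -- The times `0` and `t` are rescaled to `0` and `1`. Smoothness of `G` needs no distinct
    -- indices, so nothing is excluded.
    refine le_zero_of_triangle_of_le_rpow (F := ∅) (K := C * |t| ^ r) (r := r)
      (δ := δ / (|t| + 1)) Set.finite_empty (Set.notMem_empty _) (Set.notMem_empty _) ?_
      (by positivity) hr (by positivity) ?_
    · intro u v w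
      simp only [D]
      refine le_trans ?_ (integral_add ((hI _).sub (hI _)).abs ((hI _).sub (hI _)).abs).le
      exact integral_mono ((hI _).sub (hI _)).abs
        (((hI _).sub (hI _)).abs.add ((hI _).sub (hI _)).abs) fun ω => abs_sub_le _ _ _
    · intro u v _ _ huv
      refine (hG.smooth (t * u) (t * v) A hA).trans ?_
      have e : |t * u - t * v| = |t| * |u - v| := by rw [← mul_sub, abs_mul]
      have hlt : |t * u - t * v| < δ := by
        rw [e]
        calc |t| * |u - v| ≤ (|t| + 1) * |u - v| := by gcongr; linarith
          _ < (|t| + 1) * (δ / (|t| + 1)) := by gcongr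
          _ = δ := by field_simp
      refine (hb _ _ hlt).trans_eq ?_
      rw [e, Real.mul_rpow (abs_nonneg _) (abs_nonneg _)]
      ring
  have h0 : D 0 1 = 0 := le_antisymm hD (integral_nonneg fun ω => abs_nonneg _)
  have h1 := (integral_eq_zero_iff_of_nonneg (fun ω => abs_nonneg _)
    ((hI _).sub (hI _)).abs).1 h0
  filter_upwards [h1] with ω hω
  have : evalProcess G A t ω = evalProcess G A 0 ω := by
    have : evalProcess G A 0 ω - evalProcess G A t ω = 0 := by simpa using hω
    linarith
  exact (measureReal_eq_measureReal_iff).1 this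

omit [IsProbabilityMeasure P] in
theorem isWeakSenseStationary_of_ae_eq {Y : ℝ → Ω → ℝ} {Y₀ : Ω → ℝ} (hY₀ : MemLp Y₀ 2 P)
    (h : ∀ t, Y t =ᵐ[P] Y₀) : IsWeakSenseStationary P Y := by
  have hmean : ∀ t, ∫ ω, Y t ω ∂P = ∫ ω, Y₀ ω ∂P := fun t => integral_congr_ae (h t)
  have hcov : ∀ s t, cov[Y s, Y t; P] = cov[Y₀, Y₀; P] := fun s t => by
    simp only [covariance, hmean]
    refine integral_congr_ae ?_
    filter_upwards [h s, h t] with ω hs ht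
    rw [hs, ht]
  exact ⟨fun t => hY₀.ae_eq (h t).symm, fun t Δ => (hmean _).trans (hmean _).symm,
    fun s t Δ => (hcov _ _).trans (hcov _ _).symm⟩

end Mixing

/-! ### The step process and its mixing processes -/

section Step

/-- A continuous function on `ℝ` does not agree with a unit step on the rationals. -/
theorem not_continuous_of_eq_step {f : ℝ → ℝ} (hf : Continuous f) (u : ℝ)
    (h : ∀ q : ℚ, f q = if u ≤ q then 1 else 0) : False := by
  -- By density of the rationals, continuity confines `f` to `{0, 1}`, while the intermediate value
  -- theorem yields the value `1 / 2`.
  have hall : ∀ x, f x = 0 ∨ f x = 1 := fun x => by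
    refine Rat.denseRange_cast.induction_on (p := fun x => f x = 0 ∨ f x = 1) x
      ((isClosed_eq hf continuous_const).union (isClosed_eq hf continuous_const)) fun q => ?_
    rw [h q]
    split_ifs <;> simp
  obtain ⟨a, ha⟩ := exists_rat_lt u
  obtain ⟨b, hb⟩ := exists_rat_gt u
  obtain ⟨x, hx⟩ := mem_range_of_exists_le_of_exists_ge (c := 1 / 2) hf
    ⟨a, by rw [h, if_neg (not_le.2 ha)]; norm_num⟩ ⟨b, by rw [h, if_pos hb.le]; norm_num⟩
  rcases hall x with h0 | h0 <;> rw [h0] at hx <;> norm_num at hx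

variable {Ω : Type*} [MeasurableSpace Ω] {P : Measure Ω} [IsProbabilityMeasure P] {U : Ω → ℝ}

theorem measurable_stepProcess (hU : Measurable U) (t : ℝ) : Measurable (stepProcess U t) :=
  Measurable.ite (hU measurableSet_Iic) measurable_const measurable_const

omit [MeasurableSpace Ω] in
theorem stepMixing_coe (U : Ω → ℝ) (t : ℝ) (ω : Ω) :
    (stepMixing U t ω : Measure ℝ) = Measure.dirac (stepProcess U t ω) := by
  by_cases h : U ω ≤ t <;> simp [stepMixing, stepProcess, h]

theorem measurable_stepMixing (hU : Measurable U) (t : ℝ) : Measurable (stepMixing U t) :=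
  Measurable.ite (hU measurableSet_Iic) measurable_const measurable_const

/-- The values at two times differ only if `U` falls between them. -/
theorem measureReal_stepProcess_ne_le
    (hP : ∀ a b, a ≤ b → P.real (U ⁻¹' Set.Ioc a b) ≤ b - a) (t t' : ℝ) :
    P.real {ω | stepProcess U t ω ≠ stepProcess U t' ω} ≤ min |t - t'| 1 := by
  refine le_min ?_ measureReal_le_one
  wlog htt : t ≤ t' generalizing t t'
  · have := this t' t (le_of_not_ge htt)
    rw [abs_sub_comm] at this
    simpa only [ne_comm] using this
  rw [abs_sub_comm, abs_of_nonneg (sub_nonneg.2 htt)]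
  refine (measureReal_mono ?_).trans (hP t t' htt)
  intro ω hω
  simp only [stepProcess, ne_eq, Set.mem_ofPred_eq] at hω
  simp only [Set.mem_preimage, Set.mem_Ioc]
  by_contra hcon
  refine hω ?_
  by_cases h1 : U ω ≤ t
  · rw [if_pos h1, if_pos (h1.trans htt)]
  · rw [if_neg h1, if_neg fun h2 => hcon ⟨not_le.1 h1, h2⟩]

/-- Both vectors live on the same space, so their total variation distance is at most the
probability that they differ; a union bound finishes. -/
theorem isLocallyExchangeable_stepProcess (hU : Measurable U)
    (hP : ∀ a b, a ≤ b → P.real (U ⁻¹' Set.Ioc a b) ≤ b - a) :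
    IsLocallyExchangeable P (stepProcess U) fun t t' => min |t - t'| 1 := by
  intro T π _
  have hm1 : Measurable (restrictTo (stepProcess U) T) :=
    measurable_pi_lambda _ fun t => measurable_stepProcess hU t
  have hm2 : Measurable (reindex (stepProcess U) T π) :=
    measurable_pi_lambda _ fun t => measurable_stepProcess hU _
  have : Nonempty {A : Set (T → ℝ) // MeasurableSet A} := ⟨⟨∅, .empty⟩⟩
  refine ciSup_le fun ⟨A, hA⟩ => ?_
  simp only
  rw [map_measureReal_apply hm1 hA, map_measureReal_apply hm2 hA]
  set N : Set Ω := ⋃ t : T, {ω | stepProcess U t ω ≠ stepProcess U (π t) ω} with hN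
  have hagree : ∀ ω, ω ∉ N → restrictTo (stepProcess U) T ω = reindex (stepProcess U) T π ω := by
    intro ω hω
    simp only [hN, Set.mem_iUnion, Set.mem_ofPred_eq, not_exists, not_not] at hω
    exact funext hω
  have hNle : P.real N ≤ ∑ t : T, min |(t : ℝ) - π t| 1 :=
    (measureReal_iUnion_fintype_le _).trans
      (Finset.sum_le_sum fun t _ => measureReal_stepProcess_ne_le hP _ _)
  have hsub : ∀ {f g : Ω → T → ℝ}, (∀ ω, ω ∉ N → f ω = g ω) →
      P.real (f ⁻¹' A) - P.real (g ⁻¹' A) ≤ P.real N := by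
    intro f g hfg
    rw [sub_le_iff_le_add']
    refine (measureReal_mono (fun ω hω => ?_)).trans (measureReal_union_le _ _)
    by_cases h : ω ∈ N
    · exact Or.inr h
    · exact Or.inl (by rw [Set.mem_preimage, ← hfg ω h]; exact hω)
  refine (abs_le.2 ⟨?_, hsub hagree⟩).trans hNle
  have := hsub fun ω hω => (hagree ω hω).symm
  linarith

/-- `X` is `σ(G)`-measurable since `X_t = G_t({1})`. Conditioning thus leaves indicators unchanged,
matching a product of Dirac masses at the observed values. -/
theorem isMixingProcess_stepMixing (hU : Measurable U)
    (hP : ∀ a b, a ≤ b → P.real (U ⁻¹' Set.Ioc a b) ≤ b - a) :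
    IsMixingProcess P (stepProcess U) (fun t t' => min |t - t'| 1) (stepMixing U) := by
  refine ⟨measurable_stepMixing hU, fun T B hB => ?_, fun t t' A hA => ?_⟩
  · have hle := sigmaOf_le (measurable_stepMixing hU)
    have hcoord : ∀ t, Measurable[sigmaOf (stepMixing U)] (stepProcess U t) := by
      intro t
      have h := (measurable_real_apply (measurableSet_singleton (1 : ℝ))).comp
        (measurable_sigmaOf (stepMixing U) t)
      convert h using 1
      ext ω
      simp only [Function.comp_apply, stepMixing_coe, measureReal_def]
      simp only [stepProcess]
      split_ifs <;> simp
    have hr : Measurable[sigmaOf (stepMixing U)] (restrictTo (stepProcess U) T) :=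
      @measurable_pi_lambda _ _ _ (sigmaOf (stepMixing U)) _ _ fun t => hcoord t
    have hsm : StronglyMeasurable[sigmaOf (stepMixing U)]
        ((restrictTo (stepProcess U) T ⁻¹' B).indicator fun _ => (1 : ℝ)) :=
      (stronglyMeasurable_const).indicator (hr hB)
    rw [condExp_of_stronglyMeasurable hle hsm
      ((integrable_const _).indicator (hle _ (hr hB)))]
    refine ae_of_all _ fun ω => ?_
    have hdirac : (Measure.pi fun t : T => (stepMixing U t ω : Measure ℝ)) =
        Measure.dirac (restrictTo (stepProcess U) T ω) := by
      refine (Measure.pi_eq fun s hs => ?_)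
      rw [Measure.dirac_apply' _ (MeasurableSet.univ_pi hs)]
      have hmem : restrictTo (stepProcess U) T ω ∈ Set.univ.pi s ↔
          ∀ t ∈ Finset.univ, stepProcess U (t : T) ω ∈ s t := by simp [Set.mem_pi, restrictTo]
      simp only [stepMixing_coe, Measure.dirac_apply' _ (hs _), Set.indicator,
        Pi.one_apply, Finset.prod_ite_zero, Finset.prod_const_one]
      by_cases h : restrictTo (stepProcess U) T ω ∈ Set.univ.pi s
      · rw [if_pos h, if_pos (hmem.1 h)]
      · rw [if_neg h, if_neg (hmem.not.1 h)]
    simp only [hdirac, measureReal_def, Measure.dirac_apply' _ hB]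
    by_cases h : restrictTo (stepProcess U) T ω ∈ B <;> simp [Set.indicator, h]
  · refine le_trans ?_ (measureReal_stepProcess_ne_le hP t t')
    have hN : MeasurableSet {ω | stepProcess U t ω ≠ stepProcess U t' ω} :=
      (measurableSet_eq_fun (measurable_stepProcess hU t) (measurable_stepProcess hU t')).compl
    rw [← integral_indicator_one hN]
    refine integral_mono (((integrable_evalProcess (measurable_stepMixing hU) hA t).sub
      (integrable_evalProcess (measurable_stepMixing hU) hA t')).abs)
      ((integrable_const (1 : ℝ)).indicator hN) fun ω => ?_
    simp only [stepMixing_coe]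
    by_cases h : stepProcess U t ω = stepProcess U t' ω
    · simp [h]
    · rw [Set.indicator_of_mem (by exact h)]
      have h1 : (Measure.dirac (stepProcess U t ω)).real A ≤ 1 := measureReal_le_one
      have h2 : (Measure.dirac (stepProcess U t' ω)).real A ≤ 1 := measureReal_le_one
      have h3 : 0 ≤ (Measure.dirac (stepProcess U t ω)).real A := measureReal_nonneg
      have h4 : 0 ≤ (Measure.dirac (stepProcess U t' ω)).real A := measureReal_nonneg
      exact abs_le.2 ⟨by simp only [Pi.one_apply]; linarith, by simp only [Pi.one_apply]; linarith⟩

variable {G : ℝ → Ω → ProbabilityMeasure ℝ}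

omit [MeasurableSpace Ω] in
theorem stepProcess_eq_one_iff {t : ℝ} {ω : Ω} : stepProcess U t ω = 1 ↔ U ω ≤ t := by
  simp [stepProcess]

/-- Every mixing process of the step process puts all its mass on the current value. -/
theorem IsMixingProcess.evalProcess_one_ae_eq (hU : Measurable U)
    (hG : IsMixingProcess P (stepProcess U) (fun t t' => min |t - t'| 1) G) (t : ℝ) :
    evalProcess G {1} t =ᵐ[P] stepProcess U t := by
  have hX := measurable_stepProcess hU
  have h1 : MeasurableSet ({1} : Set ℝ) := measurableSet_singleton 1
  have ha0 : ∀ s ω, 0 ≤ evalProcess G {1} s ω := fun _ _ => measureReal_nonneg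
  have ha1 : ∀ s ω, evalProcess G {1} s ω ≤ 1 := fun _ _ => measureReal_le_one
  have hI := integrable_evalProcess (P := P) hG.measurable h1
  have hcompl : ∀ s ω, evalProcess G {1}ᶜ s ω = 1 - evalProcess G {1} s ω := fun s ω => by
    simp only [evalProcess]
    rw [measureReal_compl h1]
    simp
  have hprod : ∀ s s', Integrable
      (fun ω => evalProcess G {1} s ω * (1 - evalProcess G {1} s' ω)) P := fun s s' =>
    ((integrable_const 1).sub (hI s')).bdd_mul (c := 1)
      (measurable_evalProcess hG.measurable h1 s).aestronglyMeasurable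
      (ae_of_all _ fun ω => by rw [Real.norm_eq_abs, abs_of_nonneg (ha0 s ω)]; exact ha1 s ω)
  -- Paths are nondecreasing, so `X_s = 1` with `X_t = 0` is impossible.
  have hlt : ∀ s < t, ∫ ω, evalProcess G {1} s ω * (1 - evalProcess G {1} t ω) ∂P = 0 := by
    intro s hst
    have := hG.setIntegral_prod hX {s, t} (A := fun i => if i = s then {1} else {1}ᶜ)
      (fun i => by split_ifs; exacts [h1, h1.compl]) (S := Set.univ) .univ
    simp only [Finset.prod_pair hst.ne, if_true, if_neg hst.ne', hcompl,
      Measure.restrict_univ] at this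
    rw [this]
    have hemp : {ω | ∀ i ∈ ({s, t} : Finset ℝ),
        stepProcess U i ω ∈ if i = s then ({1} : Set ℝ) else {1}ᶜ} = ∅ := by
      refine Set.eq_empty_of_forall_notMem fun ω hω => ?_
      have hs := hω s (by simp)
      have ht := hω t (by simp)
      simp only [if_true, if_neg hst.ne', Set.mem_singleton_iff, Set.mem_compl_iff,
        stepProcess_eq_one_iff] at hs ht
      exact ht (hs.trans hst.le)
    rw [hemp, Set.empty_inter, measureReal_empty]
  -- Replacing `s` by `t` in the vanishing integral costs at most `t - s` by smoothness. Letting `s`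
  -- increase to `t` shows that `G_t({1})` is almost surely 0 or 1.
  have hbound : ∀ s < t, ∫ ω, evalProcess G {1} t ω * (1 - evalProcess G {1} t ω) ∂P ≤ t - s := by
    intro s hst
    have hsm := hG.smooth t s {1} h1
    have hle : min |t - s| 1 ≤ t - s :=
      (min_le_left _ _).trans_eq (abs_of_pos (sub_pos.2 hst))
    calc ∫ ω, evalProcess G {1} t ω * (1 - evalProcess G {1} t ω) ∂P
        = ∫ ω, evalProcess G {1} t ω * (1 - evalProcess G {1} t ω) ∂P -
          ∫ ω, evalProcess G {1} s ω * (1 - evalProcess G {1} t ω) ∂P := by rw [hlt s hst, sub_zero]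
      _ = ∫ ω, (evalProcess G {1} t ω * (1 - evalProcess G {1} t ω) -
          evalProcess G {1} s ω * (1 - evalProcess G {1} t ω)) ∂P :=
          (integral_sub (hprod _ _) (hprod _ _)).symm
      _ ≤ ∫ ω, |(evalProcess G {1} t ω) - evalProcess G {1} s ω| ∂P := by
          refine integral_mono ((hprod _ _).sub (hprod _ _)) ((hI _).sub (hI _)).abs fun ω => ?_
          simp only
          rw [← sub_mul]
          refine (le_abs_self _).trans ?_
          rw [abs_mul, abs_of_nonneg (sub_nonneg.2 (ha1 t ω))]
          exact mul_le_of_le_one_right (abs_nonneg _) (by linarith [ha0 t ω])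
      _ ≤ t - s := hsm.trans hle
  have hzero : ∫ ω, evalProcess G {1} t ω * (1 - evalProcess G {1} t ω) ∂P = 0 := by
    refine le_antisymm (le_of_forall_pos_le_add fun ε hε => ?_)
      (integral_nonneg fun ω => mul_nonneg (ha0 _ _) (sub_nonneg.2 (ha1 _ _)))
    have := hbound (t - ε) (by linarith)
    linarith
  have hae := (integral_eq_zero_iff_of_nonneg
    (fun ω => mul_nonneg (ha0 t ω) (sub_nonneg.2 (ha1 t ω))) (hprod t t)).1 hzero
  -- On a `σ(G)`-event where `G_t(A) = 0`, the value `X_t` almost surely avoids `A`. With `A = {1}`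
  -- and its complement this identifies `X_t` with `G_t({1})`.
  have hsing : ∀ {A : Set ℝ} {S : Set Ω}, MeasurableSet A → MeasurableSet[sigmaOf G] S →
      (∀ ω ∈ S, evalProcess G A t ω = 0) → ∀ᵐ ω ∂P, ω ∈ S → stepProcess U t ω ∉ A := by
    intro A S hA hS h0
    have h := hG.setIntegral_prod hX {t} (A := fun _ => A) (fun _ => hA) hS
    simp only [Finset.prod_singleton, Finset.mem_singleton, forall_eq] at h
    rw [setIntegral_eq_zero_of_forall_eq_zero h0] at h
    have h' := (measureReal_eq_zero_iff).1 h.symm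
    filter_upwards [measure_eq_zero_iff_ae_notMem.1 h'] with ω hω hωS hωA
    exact hω ⟨hωA, hωS⟩
  have hmeas : Measurable[sigmaOf G] (evalProcess G {1} t) :=
    (measurable_real_apply h1).comp (measurable_sigmaOf G t)
  have e0 := hsing (A := {1}) (S := evalProcess G {1} t ⁻¹' {0}) h1
    (hmeas (measurableSet_singleton 0)) fun ω hω => hω
  have e1 := hsing (A := {1}ᶜ) (S := evalProcess G {1} t ⁻¹' {1}) h1.compl
    (hmeas h1) fun ω hω => by
      rw [hcompl, show evalProcess G {1} t ω = 1 from hω, sub_self]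
  filter_upwards [hae, e0, e1] with ω hω h0 h1
  rcases mul_eq_zero.1 hω with hz | hz
  · have := h0 hz
    rw [hz]
    simp only [Set.mem_singleton_iff, stepProcess_eq_one_iff] at this
    simp [stepProcess, this]
  · have ho : evalProcess G {1} t ω = 1 := by linarith
    have := h1 ho
    rw [ho]
    simpa using (not_not.1 this : stepProcess U t ω = 1).symm

/-- With `G_t` carried by `{0, 1}`, the mass at 1 can be read off by integrating a continuous
function. -/
theorem IsMixingProcess.compl_pair_ae_eq_zero (hU : Measurable U)
    {d : ℝ → ℝ → ℝ} (hG : IsMixingProcess P (stepProcess U) d G) (t : ℝ) :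
    ∀ᵐ ω ∂P, (G t ω : Measure ℝ) {0, 1}ᶜ = 0 := by
  have hA : MeasurableSet ({0, 1}ᶜ : Set ℝ) := (Set.toFinite _).measurableSet.compl
  have h := hG.setIntegral_prod (measurable_stepProcess hU) {t} (A := fun _ => {0, 1}ᶜ)
    (fun _ => hA) (S := Set.univ) .univ
  simp only [Finset.prod_singleton, Finset.mem_singleton, forall_eq, Measure.restrict_univ] at h
  have hemp : {ω | stepProcess U t ω ∈ ({0, 1}ᶜ : Set ℝ)} = ∅ := by
    refine Set.eq_empty_of_forall_notMem fun ω hω => hω ?_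
    simp only [stepProcess]
    split_ifs <;> simp
  rw [hemp, Set.empty_inter, measureReal_empty] at h
  have := (integral_eq_zero_iff_of_nonneg (fun ω => measureReal_nonneg)
    (integrable_evalProcess hG.measurable hA t)).1 h
  filter_upwards [this] with ω hω
  exact (measureReal_eq_zero_iff).1 hω

theorem IsMixingProcess.not_hasContinuousModification_evalProcess (hU : Measurable U)
    (hG : IsMixingProcess P (stepProcess U) (fun t t' => min |t - t'| 1) G) :
    ¬ HasContinuousModification P (evalProcess G {1}) := by
  rintro ⟨Y, hY, hc⟩
  have hq : ∀ᵐ ω ∂P, ∀ q : ℚ, Y q ω = stepProcess U q ω := ae_all_iff.2 fun q => by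
    filter_upwards [hY q, hG.evalProcess_one_ae_eq hU q] with ω h1 h2
    rw [← h1, h2]
  obtain ⟨ω, hω, hcω⟩ := (hq.and hc).exists
  exact not_continuous_of_eq_step hcω (U ω) hω

theorem IsMixingProcess.not_hasContinuousModification (hU : Measurable U)
    (hG : IsMixingProcess P (stepProcess U) (fun t t' => min |t - t'| 1) G) :
    ¬ HasContinuousModification P G := by
  rintro ⟨Y, hY, hc⟩
  -- Clamping to `[0, 1]` is bounded and continuous and agrees with the indicator of `{1}` on `{0,
  -- 1}`, so weak continuity passes to the real path.
  let φ : BoundedContinuousFunction ℝ ℝ :=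
    BoundedContinuousFunction.ofNormedAddCommGroup (fun x => max 0 (min x 1)) (by fun_prop) 1
      fun x => by
        rw [Real.norm_eq_abs, abs_of_nonneg (le_max_left _ _)]
        exact max_le zero_le_one (min_le_right _ _)
  have hq : ∀ᵐ ω ∂P, ∀ q : ℚ, ∫ x, φ x ∂(Y q ω : Measure ℝ) = stepProcess U q ω :=
    ae_all_iff.2 fun q => by
      filter_upwards [hY q, hG.evalProcess_one_ae_eq hU q, hG.compl_pair_ae_eq_zero hU q]
        with ω h1 h2 h3
      rw [← h1, ← h2]
      have : φ =ᵐ[(G q ω : Measure ℝ)] ({1} : Set ℝ).indicator 1 := by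
        filter_upwards [measure_eq_zero_iff_ae_notMem.1 h3] with x hx
        have hx' : x = 0 ∨ x = 1 := not_not.1 hx
        rcases hx' with rfl | rfl <;> simp [φ]
      rw [integral_congr_ae this, integral_indicator_one (measurableSet_singleton 1)]
      rfl
  obtain ⟨ω, hω, hcω⟩ := (hq.and hc).exists
  exact not_continuous_of_eq_step
    ((ProbabilityMeasure.continuous_integral_boundedContinuousFunction φ).comp hcω) (U ω) hω

end Step
end LocalExch

namespace LocalExch

/-! ### Consequences for an arbitrary exponent above 1 -/

section Main

variable {Ω : Type u} {𝒳 : Type v} [MeasurableSpace Ω] [MeasurableSpace 𝒳] {P : Measure Ω}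
  [IsProbabilityMeasure P] {X : ℝ → Ω → 𝒳} {d : ℝ → ℝ → ℝ} {r : ℝ}

theorem IsLocallyExchangeable.map_eq (hX : ∀ t, Measurable (X t)) (hd : IsPremetric d)
    (h : IsLocallyExchangeable P X d) (hr : 1 < r) (hO : IsBigOPower d r) {ι : Type} {f g : ι → ℝ}
    (hf : Function.Injective f) (hg : Function.Injective g) :
    (P.map fun ω i => X (f i) ω) = P.map fun ω i => X (g i) ω :=
  map_eq_of_forall_finite hX (fun hf hg => h.map_eq_of_finite hX hd hr hO hf hg) hf hg

theorem IsLocallyExchangeable.identDistrib (hX : ∀ t, Measurable (X t)) (hd : IsPremetric d)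
    (h : IsLocallyExchangeable P X d) (hr : 1 < r) (hO : IsBigOPower d r) {σ : ℝ → ℝ}
    (hσ : Function.Injective σ) :
    IdentDistrib (fun ω t => X t ω) (fun ω t => X (σ t) ω) P P :=
  ⟨(measurable_pi_lambda _ fun t => hX t).aemeasurable,
    (measurable_pi_lambda _ fun t => hX (σ t)).aemeasurable,
    h.map_eq hX hd hr hO Function.injective_id hσ⟩

theorem IsLocallyExchangeable.exists_mixing [StandardBorelSpace 𝒳]
    (hX : ∀ t, Measurable (X t)) (hd : IsPremetric d) (h : IsLocallyExchangeable P X d)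
    (hr : 1 < r) (hO : IsBigOPower d r) : ∃ G, IsMixingProcess P X d G :=
  IsSpreadable.exists_mixing hX hd fun _ _ hf hg => h.map_eq hX hd hr hO hf hg

theorem isPremetric_min_abs_sub : IsPremetric fun t t' : ℝ => min |t - t'| 1 :=
  ⟨fun _ _ => le_min (abs_nonneg _) zero_le_one, fun _ _ => min_le_right _ _,
    fun t t' => by rw [abs_sub_comm], fun t => by simp⟩

theorem isBigOPower_min_abs_sub : IsBigOPower (fun t t' : ℝ => min |t - t'| 1) (1 + 0) := by
  refine Asymptotics.IsBigO.of_bound 1 (Eventually.of_forall fun p => ?_)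
  rw [add_zero, Real.rpow_one, one_mul, Real.norm_eq_abs, Real.norm_eq_abs, abs_abs,
    abs_of_nonneg (le_min (abs_nonneg _) zero_le_one)]
  exact min_le_left _ _

end Main

end LocalExch

theorem mainTheorem5 :
    -- the cases `γ > 1` and `0 < γ ≤ 1`
    (∀ {Ω : Type u} [MeasurableSpace Ω] (P : Measure Ω) [IsProbabilityMeasure P]
      {𝒳 : Type v} [MeasurableSpace 𝒳] [StandardBorelSpace 𝒳]
      (X : ℝ → Ω → 𝒳) (_ : ∀ t, Measurable (X t))
      (d : ℝ → ℝ → ℝ) (_ : LocalExch.IsPremetric d)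
      (_ : LocalExch.IsLocallyExchangeable P X d)
      (γ : ℝ) (_ : LocalExch.IsBigOPower d (1 + γ)),
      (1 < γ →
        LocalExch.IsExchangeable P X ∧
        (∃ G, LocalExch.IsMixingProcess P X d G) ∧
        ∀ G, LocalExch.IsMixingProcess P X d G → LocalExch.IsConstantProcess P G) ∧
      (0 < γ → γ ≤ 1 →
        LocalExch.IsStationary P X ∧
        (∃ G, LocalExch.IsMixingProcess P X d G) ∧
        ∀ G, LocalExch.IsMixingProcess P X d G → ∀ A : Set 𝒳, MeasurableSet A →
          LocalExch.IsWeakSenseStationary P (LocalExch.evalProcess G A) ∧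
          ∀ α : ℝ≥0, 0 < α → (α : ℝ) < γ →
            LocalExch.HasHolderModification P (LocalExch.evalProcess G A) α)) ∧
    -- the case `γ = 0`
    (∃ (Ω : Type) (_ : MeasurableSpace Ω) (P : Measure Ω) (U : Ω → ℝ) (d : ℝ → ℝ → ℝ),
      IsProbabilityMeasure P ∧ Measurable U ∧ pdf.IsUniform U (Set.Icc 0 1) P volume ∧
      (∀ t t', d t t' = min |t - t'| 1) ∧
      LocalExch.IsPremetric d ∧
      LocalExch.IsBigOPower d (1 + 0) ∧
      (∀ t, Measurable (LocalExch.stepProcess U t)) ∧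
      LocalExch.IsLocallyExchangeable P (LocalExch.stepProcess U) d ∧
      LocalExch.IsMixingProcess P (LocalExch.stepProcess U) d (LocalExch.stepMixing U) ∧
      ∀ G, LocalExch.IsMixingProcess P (LocalExch.stepProcess U) d G →
        ¬ LocalExch.HasContinuousModification P G ∧
        ¬ LocalExch.HasContinuousModification P (LocalExch.evalProcess G {1})) := by
  open LocalExch in
  refine ⟨?_, ?_⟩
  · intro Ω _ P _ 𝒳 _ _ X hX d hd h γ hO
    refine ⟨fun hγ => ?_, fun hγ _ => ?_⟩
    · have hr : 1 < 1 + γ := by linarith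
      exact ⟨fun σ _ => h.identDistrib hX hd hr hO σ.injective,
        h.exists_mixing hX hd hr hO,
        fun G hG => ⟨G 0, hG.measurable 0, fun t => hG.ae_eq_zero hd hr hO t⟩⟩
    · have hr : 1 < 1 + γ := by linarith
      refine ⟨fun Δ => h.identDistrib hX hd hr hO (add_left_injective Δ),
        h.exists_mixing hX hd hr hO, fun G hG A hA => ?_⟩
      have hae : ∀ t, evalProcess G A t =ᵐ[P] evalProcess G A 0 := fun t => by
        filter_upwards [hG.ae_eq_zero hd hr hO t] with ω hω
        simp only [evalProcess, hω]
      exact ⟨isWeakSenseStationary_of_ae_eq (memLp_evalProcess hG.measurable hA 0 2) hae,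
        -- The modification is frozen at time 0, hence Hölder with constant 0.
        fun α _ _ => ⟨fun _ => evalProcess G A 0, fun _ => measurable_evalProcess hG.measurable hA 0,
          hae, fun ω => ⟨0, HolderWith.const⟩⟩⟩
  · have hvol : volume (Set.Icc (0 : ℝ) 1) = 1 := by simp
    have hprob : IsProbabilityMeasure (volume.restrict (Set.Icc (0 : ℝ) 1)) :=
      ⟨by rw [Measure.restrict_apply_univ, hvol]⟩
    have hP : ∀ a b : ℝ, a ≤ b →
        (volume.restrict (Set.Icc (0 : ℝ) 1)).real (id ⁻¹' Set.Ioc a b) ≤ b - a := by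
      intro a b hab
      rw [Set.preimage_id, measureReal_restrict_apply measurableSet_Ioc]
      refine (measureReal_mono Set.inter_subset_left (by simp)).trans_eq ?_
      rw [Real.volume_real_Ioc_of_le hab]
    -- `U` is the identity under Lebesgue measure on `[0, 1]`, viewed as a measure on `ℝ`.
    refine ⟨ℝ, inferInstance, volume.restrict (Set.Icc 0 1), id, fun t t' => min |t - t'| 1, hprob,
      measurable_id, ?_, fun _ _ => rfl, isPremetric_min_abs_sub, isBigOPower_min_abs_sub,
      measurable_stepProcess measurable_id, isLocallyExchangeable_stepProcess measurable_id hP,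
      isMixingProcess_stepMixing measurable_id hP, fun G hG =>
        ⟨hG.not_hasContinuousModification measurable_id,
          hG.not_hasContinuousModification_evalProcess measurable_id⟩⟩
    rw [pdf.IsUniform, Measure.map_id, ProbabilityTheory.cond, hvol, inv_one, one_smul]
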